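/- All graphs are finite, simple and undirected. Initially every vertex of a graph $G$ is dirty. A configuration places a nonnegative integer number of brushes on each vertex. A dirty vertex holding at least as many brushes as it has dirty neighbors may fire: it sends one brush to each dirty neighbor and becomes clean. The brush number $b(G)$ is the least total number of brushes in a configuration from which some sequence of firings cleans every vertex. In the brushing game there are initially no brushes; players Min and Max, with Min moving first, alternately place one brush on a dirty vertex of their choice, and after each placement vertices fire until no further vertex can fire (the outcome does not depend on the order of firings). The game ends when all vertices are clean. Min wants to minimize, and Max to maximize, the number of brushes placed; the length of the game under optimal play is the game brush number $b_g(G)$. For integers $n \ge 3$ and $1 \le k \le n$, let $G_{n,k}$ be the graph obtained from the $n$-sunlet (the cycle $C_n$ with one pendant leaf attached to each vertex) by choosing $k$ consecutive pendant edges and subdividing each of them $n$ times, i.e. replacing it by a path with $n+1$ edges. **Theorem.** For every rational number $r$ with $1 \le r < 2$ there is a graph $G$ such that $$\frac{b_g(G)}{b(G)} = r;$$ moreover $G$ can be taken to be $G_{n,k}$ for some $n \ge 3$ and $1 \le k \le n$ with $k \ne n-1$. For all $n \ge 3$ and $1 \le k \le n$ one has $b(G_{n,k}) = n$, and if in addition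 $k \ne n-1$, then $b_g(G_{n,k}) = n+k-1$. -/

import Mathlib

namespace Brushing

/-- A position of the brushing process: the number of brushes on each vertex, and the set of
vertices that are still dirty. -/
structure State (V : Type*) where
  brushes : V → ℕ
  dirty : Finset V

variable {V : Type*} [Fintype V] [DecidableEq V] (G : SimpleGraph V) [DecidableRel G.Adj]

/-- The number of dirty neighbours of `v`. -/
def State.dirtyDegree (s : State V) (v : V) : ℕ :=
  (s.dirty.filter (fun w => G.Adj v w)).card

/-- The dirty vertex `v` may fire: it has at least as many brushes as dirty neighbours. -/
def State.CanFire (s : State V) (v : V) : Prop :=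
  v ∈ s.dirty ∧ s.dirtyDegree G v ≤ s.brushes v

/-- The result of firing `v`: one brush moves from `v` to each dirty neighbour, and `v` becomes
clean. -/
def State.fire (s : State V) (v : V) : State V where
  brushes w :=
    if w = v then s.brushes v - s.dirtyDegree G v
    else if w ∈ s.dirty ∧ G.Adj v w then s.brushes w + 1
    else s.brushes w
  dirty := s.dirty.erase v

/-- One step of the cleaning process: some vertex that may fire does so. -/
def FireStep (s t : State V) : Prop :=
  ∃ v, s.CanFire G v ∧ t = s.fire G v

/-- `t` is obtained from `s` by a finite list of firings. -/
def Reaches (s t : State V) : Prop :=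
  Relation.ReflTransGen (FireStep G) s t

/-- `t` is obtained from `s` by a maximal list of firings. -/
def StabilizesTo (s t : State V) : Prop :=
  Reaches G s t ∧ ∀ v, ¬ t.CanFire G v

/-- The start of the cleaning process on the configuration `f`: all vertices are dirty. -/
def initial (f : V → ℕ) : State V := ⟨f, Finset.univ⟩

/-- The configuration `f` cleans `G`: some list of firings from `f` cleans every vertex. -/
def CleanedBy (f : V → ℕ) : Prop :=
  ∃ t, Reaches G (initial f) t ∧ t.dirty = ∅

/-- The brush number `b(G)`: the least number of brushes in a configuration that cleans `G`. -/
noncomputable def brushNumber : ℕ :=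
  sInf {m | ∃ f : V → ℕ, CleanedBy G f ∧ ∑ v, f v = m}

/-- Add one brush on `v`. -/
def State.place (s : State V) (v : V) : State V where
  brushes := Function.update s.brushes v (s.brushes v + 1)
  dirty := s.dirty

inductive Player where
  | min
  | max

/-- `EndsWithin G t p s`: with player `p` to move in the stable position `s`, Min can force the
game to end after at most `t` further turns. A turn consists of placing one brush on a dirty vertex
and then firing vertices until the position is stable; the game is over when no vertex is dirty. -/
def EndsWithin : ℕ → Player → State V → Prop
  | 0, _, s => s.dirty = ∅
  | t + 1, .min, s => s.dirty = ∅ ∨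
      ∃ v ∈ s.dirty, ∀ s', StabilizesTo G (s.place v) s' → EndsWithin t .max s'
  | t + 1, .max, s => s.dirty = ∅ ∨
      ∀ v ∈ s.dirty, ∀ s', StabilizesTo G (s.place v) s' → EndsWithin t .min s'

/-- The game brush number `b_g(G)`: the length, under optimal play, of the brushing game in which
Min moves first. The game starts without brushes (isolated vertices are clean from the outset). -/
noncomputable def gameBrushNumber : ℕ :=
  sInf {t | ∀ s, StabilizesTo G (initial fun _ => 0) s → EndsWithin G t .min s}

/-- The number of edges of the pendant path at the `i`-th cycle vertex: a pendant edge subdivided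
`n` times is a path with `n + 1` edges. -/
def threadLength (n k : ℕ) (i : Fin n) : ℕ :=
  if i.val < k then n + 1 else 1

/-- Vertices of the subdivided sunlet: `⟨i, j⟩` is the vertex at distance `j` from the `i`-th cycle
vertex `⟨i, 0⟩` on the pendant path attached there. -/
abbrev SunletVertex (n k : ℕ) : Type :=
  (i : Fin n) × Fin (threadLength n k i + 1)

/-- The `n`-sunlet (the cycle `C_n` with one pendant leaf attached to each vertex) in which `k`
consecutive pendant edges have each been subdivided `n` times. -/
def subdividedSunlet (n k : ℕ) : SimpleGraph (SunletVertex n k) where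
  Adj a b :=
    (a.2.val = 0 ∧ b.2.val = 0 ∧ (SimpleGraph.cycleGraph n).Adj a.1 b.1) ∨
    (a.1 = b.1 ∧ (a.2.val + 1 = b.2.val ∨ b.2.val + 1 = a.2.val))
  symm := ⟨by
    rintro a b (⟨h1, h2, h3⟩ | ⟨h1, h2⟩)
    · exact Or.inl ⟨h2, h1, h3.symm⟩
    · exact Or.inr ⟨h1.symm, h2.symm⟩⟩
  loopless := ⟨by
    rintro a (⟨_, _, h⟩ | ⟨_, h⟩)
    · exact h.ne rfl
    · omega⟩

instance (n k : ℕ) : DecidableRel (subdividedSunlet n k).Adj := fun a b =>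
  inferInstanceAs (Decidable (
    (a.2.val = 0 ∧ b.2.val = 0 ∧ (SimpleGraph.cycleGraph n).Adj a.1 b.1) ∨
    (a.1 = b.1 ∧ (a.2.val + 1 = b.2.val ∨ b.2.val + 1 = a.2.val))))

end Brushing

/-! While `v` is dirty its `load` (brushes plus dirty neighbours) is unaffected by firings
elsewhere: each newly clean neighbour becomes a brush. Since `v` may fire exactly when its load is
at least twice its dirty degree, half the load, rounded down, is the number of edges that `v` can
serve. Twice the number of dirty edges minus twice these capacities is `deficit`. A brush lowers it
by 2 on an odd load and is wasted on an even one; firing never lowers it (`deficit_le_fire`). It is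
initially `2 * n`, one unit per cycle vertex and one per leaf, and finally 0, so `n` brushes are
needed; `exists_cleanedBy` gives `n` that suffice.

In the game, `deficit / 2 + total - n` counts waste. A dirty long thread has `n` inner vertices, so
Max can waste a brush there until the waste reaches `k - 1` (`State.Settled.exists_wasting`,
`le_add_of_endsWithin`). If Max has wasted on every turn so far and the game ends early, at least `2
* n - 1` brushes were used anyway.

For the upper bound, firing wastes nothing unless it completes the cleaning, because the vertices
fired then induce a forest (`sum_degIn_add_two_le`). Max's remaining chances to waste are bounded by
the dirty long threads and the even cycle vertices; adding these to `deficit` and `total` gives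
`State.cost`. Max raises the cost by at most 2 per turn, and Min lowers it by 2 while such chances
exist, by brushing the tip of a long thread or of the thread at an even cycle vertex
(`State.MaxSafe.turn`, `State.MinSafe.exists_move`). Positions with the whole cycle dirty need a
separate bound by counting turns; this is where `k ≠ n - 1` enters. -/

namespace Brushing

set_option linter.unusedSectionVars false

/-! ### Loads, the deficit, and the effect of one turn on an arbitrary graph -/

section General

variable {V : Type*} [Fintype V] [DecidableEq V] (G : SimpleGraph V) [DecidableRel G.Adj]

/-- The number of neighbours of `v` in the set `S`. -/
def degIn (S : Finset V) (v : V) : ℕ := (S.filter (fun w => G.Adj v w)).card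

/-- Brushes plus dirty neighbours. While `v` is dirty, the firings of other vertices do not change
this number. -/
def State.load (s : State V) (v : V) : ℕ := s.brushes v + s.dirtyDegree G v

/-- Twice the number of further brushes that are needed if none is wasted. -/
def State.deficit (s : State V) : ℤ :=
  ∑ v ∈ s.dirty, ((s.dirtyDegree G v : ℤ) - 2 * (s.load G v / 2 : ℕ))

/-- The total number of brushes. -/
def State.total (s : State V) : ℕ := ∑ v, s.brushes v

/-- Every dirty vertex has received a brush from each of its clean neighbours. -/
def State.Fed (s : State V) : Prop := ∀ v ∈ s.dirty, degIn G Finset.univ v ≤ s.load G v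

theorem State.dirtyDegree_eq (s : State V) (v : V) : s.dirtyDegree G v = degIn G s.dirty v := rfl

theorem degIn_union {S T : Finset V} (h : Disjoint S T) (v : V) :
    degIn G (S ∪ T) v = degIn G S v + degIn G T v := by
  unfold degIn
  rw [Finset.filter_union, Finset.card_union_of_disjoint]
  exact Finset.disjoint_filter_filter h

theorem sum_degIn_comm (S T : Finset V) : ∑ v ∈ S, degIn G T v = ∑ v ∈ T, degIn G S v := by
  simp only [degIn, Finset.card_filter]
  rw [Finset.sum_comm]
  simp only [G.adj_comm]

theorem sum_degIn_union {S R : Finset V} (h : Disjoint S R) :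
    (∑ v ∈ S ∪ R, (degIn G (S ∪ R) v : ℤ)) =
      ∑ v ∈ S, (degIn G S v : ℤ) + 2 * ∑ v ∈ R, (degIn G (S ∪ R) v : ℤ)
        - ∑ v ∈ R, (degIn G R v : ℤ) := by
  have h1 := sum_degIn_comm G S R
  rw [Finset.sum_union h]
  simp only [degIn_union G h, Nat.cast_add, Finset.sum_add_distrib]
  zify at h1
  rw [h1]
  ring

/-- Reaching a position with fewer dirty vertices and the same loads. -/
theorem deficit_sub_deficit {s t : State V} (hsub : t.dirty ⊆ s.dirty)
    (hload : ∀ v ∈ t.dirty, t.load G v = s.load G v) :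
    s.deficit G - t.deficit G =
      2 * ∑ v ∈ s.dirty \ t.dirty, ((s.dirtyDegree G v : ℤ) - (s.load G v / 2 : ℕ))
        - ∑ v ∈ s.dirty \ t.dirty, (degIn G (s.dirty \ t.dirty) v : ℤ) := by
  have hd : Disjoint t.dirty (s.dirty \ t.dirty) := Finset.disjoint_sdiff
  have hu : t.dirty ∪ (s.dirty \ t.dirty) = s.dirty := Finset.union_sdiff_of_subset hsub
  have h1 := sum_degIn_union G hd
  rw [hu] at h1
  have h2 : ∑ v ∈ s.dirty, ((s.load G v / 2 : ℕ) : ℤ) =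
      ∑ v ∈ t.dirty, ((t.load G v / 2 : ℕ) : ℤ) +
        ∑ v ∈ s.dirty \ t.dirty, ((s.load G v / 2 : ℕ) : ℤ) := by
    have h3 : ∑ v ∈ t.dirty, ((t.load G v / 2 : ℕ) : ℤ) =
        ∑ v ∈ t.dirty, ((s.load G v / 2 : ℕ) : ℤ) :=
      Finset.sum_congr rfl fun v hv => by rw [hload v hv]
    rw [h3, ← Finset.sum_union hd, hu]
  unfold State.deficit
  simp only [State.dirtyDegree_eq, Finset.sum_sub_distrib, ← Finset.mul_sum, h2, h1]
  ring

theorem canFire_iff {s : State V} {v : V} :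
    s.CanFire G v ↔ v ∈ s.dirty ∧ 2 * s.dirtyDegree G v ≤ s.load G v := by
  unfold State.CanFire State.load
  constructor <;> rintro ⟨h, h'⟩ <;> exact ⟨h, by omega⟩

/-- A neighbour of the fired vertex loses a dirty neighbour and gains a brush. -/
theorem load_fire {s : State V} {v w : V} (hv : v ∈ s.dirty) (hw : w ∈ s.dirty.erase v) :
    (s.fire G v).load G w = s.load G w := by
  obtain ⟨hne, hwd⟩ := Finset.mem_erase.1 hw
  simp only [State.load, State.dirtyDegree, State.fire, if_neg hne, Finset.filter_erase, hwd,
    true_and]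
  by_cases h : G.Adj v w
  · have hm : v ∈ s.dirty.filter (fun x => G.Adj w x) := Finset.mem_filter.2 ⟨hv, h.symm⟩
    have := Finset.card_pos.2 ⟨v, hm⟩
    rw [if_pos h, Finset.card_erase_of_mem hm]
    omega
  · have hm : v ∉ s.dirty.filter (fun x => G.Adj w x) := fun h' =>
      h (Finset.mem_filter.1 h').2.symm
    rw [if_neg h, Finset.erase_eq_of_notMem hm]

theorem total_fire {s : State V} {v : V} (h : s.CanFire G v) : (s.fire G v).total = s.total := by
  have hle : s.dirtyDegree G v ≤ s.brushes v := h.2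
  have key : ∀ w, ((s.fire G v).brushes w : ℤ) = s.brushes w
      + ((if w ∈ s.dirty ∧ G.Adj v w then (1 : ℤ) else 0)
        - if w = v then (s.dirtyDegree G v : ℤ) else 0) := by
    intro w
    simp only [State.fire]
    by_cases hw : w = v
    · subst hw
      simp [Nat.cast_sub hle, sub_eq_add_neg]
    · by_cases h2 : w ∈ s.dirty ∧ G.Adj v w <;> simp [hw, h2]
  have : ((s.fire G v).total : ℤ) = s.total := by
    simp only [State.total, Nat.cast_sum, key, Finset.sum_add_distrib, Finset.sum_sub_distrib]
    rw [Finset.sum_ite_eq' Finset.univ v, Finset.sum_boole]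
    have : (Finset.univ.filter fun w => w ∈ s.dirty ∧ G.Adj v w)
        = s.dirty.filter (fun w => G.Adj v w) := by ext; simp
    rw [this]
    simp [State.dirtyDegree]
  exact_mod_cast this

/-- Firing removes edges equal in number to the dirty degree of `v`, and this is at most the
capacity `load / 2` removed with `v`. -/
theorem deficit_le_fire {s : State V} {v : V} (h : s.CanFire G v) :
    s.deficit G ≤ (s.fire G v).deficit G := by
  have hsub : (s.fire G v).dirty ⊆ s.dirty := Finset.erase_subset _ _
  have h1 := deficit_sub_deficit G hsub fun w hw => load_fire G h.1 hw
  have h2 : s.dirty \ (s.fire G v).dirty = {v} := by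
    ext w
    have := h.1
    by_cases hw : w = v <;> simp [State.fire, hw, this]
  rw [h2] at h1
  simp only [Finset.sum_singleton] at h1
  have h3 : degIn G {v} v = 0 := by simp [degIn, Finset.filter_singleton]
  have h4 := ((canFire_iff G).1 h).2
  rw [h3] at h1
  omega

theorem Reaches.spec {s t : State V} (h : Reaches G s t) :
    t.dirty ⊆ s.dirty ∧ (∀ v ∈ t.dirty, t.load G v = s.load G v) ∧ t.total = s.total ∧
      s.deficit G ≤ t.deficit G := by
  induction h with
  | refl => exact ⟨subset_rfl, fun _ _ => rfl, rfl, le_rfl⟩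
  | tail _ hst ih =>
    obtain ⟨v, hv, rfl⟩ := hst
    obtain ⟨h1, h2, h3, h4⟩ := ih
    refine ⟨(Finset.erase_subset _ _).trans h1, fun w hw => ?_, (total_fire G hv).trans h3,
      h4.trans (deficit_le_fire G hv)⟩
    rw [load_fire G hv.1 hw, h2 w (Finset.mem_of_mem_erase hw)]

theorem exists_stabilizesTo (s : State V) : ∃ t, StabilizesTo G s t := by
  induction hc : s.dirty.card using Nat.strong_induction_on generalizing s with
  | _ m ih =>
    by_cases h : ∃ v, s.CanFire G v
    · obtain ⟨v, hv⟩ := h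
      obtain ⟨t, ht, ht'⟩ := ih _ (hc ▸ Finset.card_erase_lt_of_mem hv.1) (s.fire G v) rfl
      exact ⟨t, Relation.ReflTransGen.head ⟨v, hv, rfl⟩ ht, ht'⟩
    · exact ⟨s, Relation.ReflTransGen.refl, fun v hv => h ⟨v, hv⟩⟩

/-- A stable position in which every dirty vertex has been fed by its clean neighbours. -/
structure State.Settled (s : State V) : Prop where
  load_lt : ∀ v ∈ s.dirty, s.load G v < 2 * s.dirtyDegree G v
  fed : s.Fed G

theorem StabilizesTo.settled {s t : State V} (h : StabilizesTo G s t) (hs : s.Fed G) :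
    t.Settled G := by
  obtain ⟨h1, h2, -, -⟩ := Reaches.spec G h.1
  refine ⟨fun v hv => ?_, fun v hv => (h2 v hv) ▸ hs v (h1 hv)⟩
  by_contra hlt
  exact h.2 v ((canFire_iff G).2 ⟨hv, not_lt.1 hlt⟩)

theorem load_place (s : State V) (v w : V) :
    (s.place v).load G w = s.load G w + if w = v then 1 else 0 := by
  unfold State.load State.place State.dirtyDegree
  by_cases h : w = v
  · subst h; simp; omega
  · simp [h]

theorem total_place (s : State V) (v : V) : (s.place v).total = s.total + 1 := by
  unfold State.total State.place
  rw [Finset.sum_update_of_mem (Finset.mem_univ v), ← Finset.add_sum_erase _ _ (Finset.mem_univ v),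
    Finset.sdiff_singleton_eq_erase]
  omega

/-- Only a brush on an odd load raises `load / 2`; any other brush is wasted. -/
theorem deficit_place {s : State V} {v : V} (hv : v ∈ s.dirty) :
    (s.place v).deficit G = s.deficit G - 2 * (s.load G v % 2 : ℕ) := by
  have h : ∀ w, (((s.place v).dirtyDegree G w : ℤ) - 2 * ((s.place v).load G w / 2 : ℕ)) =
      ((s.dirtyDegree G w : ℤ) - 2 * (s.load G w / 2 : ℕ))
        - if w = v then (2 * (s.load G v % 2 : ℕ) : ℤ) else 0 := by
    intro w
    rw [load_place]
    have : (s.place v).dirtyDegree G w = s.dirtyDegree G w := rfl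
    rw [this]
    split_ifs with hw
    · subst hw; omega
    · simp
  unfold State.deficit
  rw [Finset.sum_congr rfl fun w _ => h w, Finset.sum_sub_distrib]
  change _ - ∑ w ∈ s.dirty, _ = _
  rw [Finset.sum_ite_eq' s.dirty v, if_pos hv]
  rfl

theorem State.Fed.place {s : State V} (hs : s.Fed G) (v : V) : (s.place v).Fed G := fun w hw => by
  rw [load_place]
  exact (hs w hw).trans (Nat.le_add_right _ _)

/-- What a turn does to a settled position. -/
structure Turn (s : State V) (v : V) (t : State V) : Prop where
  settled : t.Settled G
  subset : t.dirty ⊆ s.dirty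
  load : ∀ w ∈ t.dirty, t.load G w = s.load G w + if w = v then 1 else 0
  total : t.total = s.total + 1
  le_deficit : s.deficit G - 2 * (s.load G v % 2 : ℕ) ≤ t.deficit G
  deficit_sub : s.deficit G - 2 * (s.load G v % 2 : ℕ) - t.deficit G =
      2 * ∑ w ∈ s.dirty \ t.dirty,
        ((s.dirtyDegree G w : ℤ) - ((s.load G w + if w = v then 1 else 0) / 2 : ℕ))
        - ∑ w ∈ s.dirty \ t.dirty, (degIn G (s.dirty \ t.dirty) w : ℤ)
  dirty_eq : s.load G v % 2 = 0 → t.dirty = s.dirty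

theorem StabilizesTo.turn {s t : State V} (hs : s.Settled G) {v : V} (hv : v ∈ s.dirty)
    (h : StabilizesTo G (s.place v) t) : Turn G s v t := by
  obtain ⟨h1, h2, h3, h4⟩ := Reaches.spec G h.1
  have h5 := deficit_sub_deficit G h1 h2
  rw [deficit_place G hv] at h4 h5
  simp only [load_place] at h5
  refine ⟨StabilizesTo.settled G h (hs.fed.place G v), h1, fun w hw => ?_, ?_, h4, h5, fun he => ?_⟩
  · rw [h2 w hw, load_place]
  · rw [h3, total_place]
  -- In a settled position a load lies below twice the dirty degree; an even load stays below it
  -- after one more brush, so no firing can start.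
  · rcases Relation.ReflTransGen.cases_head h.1 with h0 | ⟨u, ⟨w, hw, -⟩, -⟩
    · rw [← h0]; rfl
    · exfalso
      obtain ⟨hw1, hw2⟩ := (canFire_iff G).1 hw
      have hw3 := hs.load_lt w hw1
      have : (s.place v).dirtyDegree G w = s.dirtyDegree G w := rfl
      rw [load_place, this] at hw2
      split_ifs at hw2 with hwv
      · subst hwv; omega
      · omega

/-- If the vertices fired in a turn induce a subgraph with at most `|R| - 1` edges, the turn wastes
no brush by firing. -/
theorem Turn.deficit_le {s t : State V} {v : V} (h : Turn G s v t) (hs : s.Settled G)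
    (hR : ∑ w ∈ s.dirty \ t.dirty, degIn G (s.dirty \ t.dirty) w + 2 ≤
      2 * (s.dirty \ t.dirty).card ∨ s.dirty \ t.dirty = ∅) :
    t.deficit G ≤ s.deficit G - 2 * (s.load G v % 2 : ℕ) := by
  have h1 := h.deficit_sub
  rcases hR with hR | hR
  · have h2 : ∀ w ∈ s.dirty \ t.dirty, (1 : ℤ) - (if w = v then 1 else 0) ≤
        (s.dirtyDegree G w : ℤ) - ((s.load G w + if w = v then 1 else 0) / 2 : ℕ) := by
      intro w hw
      have := hs.load_lt w (Finset.mem_sdiff.1 hw).1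
      split_ifs <;> omega
    have h3 := Finset.sum_le_sum h2
    rw [Finset.sum_sub_distrib, Finset.sum_ite_eq' _ v] at h3
    simp only [Finset.sum_const, nsmul_eq_mul, mul_one] at h3
    zify at hR
    split_ifs at h3 <;> linarith
  · rw [hR] at h1
    simp only [Finset.sum_empty] at h1
    linarith

end General

/-! ### Structure of the subdivided sunlet -/

section Sunlet

variable {n k : ℕ} [NeZero n]

theorem threadLength_pos (n k : ℕ) (i : Fin n) : 0 < threadLength n k i := by
  unfold threadLength; split_ifs <;> omega

theorem threadLength_of_lt {i : Fin n} (h : i.val < k) : threadLength n k i = n + 1 := if_pos h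

theorem threadLength_of_le {i : Fin n} (h : k ≤ i.val) : threadLength n k i = 1 :=
  if_neg (not_lt.2 h)

/-- The vertex at distance `j` from the cycle on the `i`-th thread. -/
def knot (i : Fin n) (j : ℕ) (h : j ≤ threadLength n k i) : SunletVertex n k :=
  ⟨i, ⟨j, Nat.lt_succ_of_le h⟩⟩

/-- The `i`-th cycle vertex. -/
def hub (k : ℕ) (i : Fin n) : SunletVertex n k := knot i 0 (Nat.zero_le _)

/-- The first vertex of the `i`-th thread after the cycle vertex. -/
def root (k : ℕ) (i : Fin n) : SunletVertex n k := knot i 1 (threadLength_pos n k i)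

/-- The leaf at the end of the `i`-th thread. -/
def tip (k : ℕ) (i : Fin n) : SunletVertex n k := knot i (threadLength n k i) le_rfl

theorem knot_inj {i i' : Fin n} {j j' : ℕ} {h : j ≤ threadLength n k i}
    {h' : j' ≤ threadLength n k i'} : knot i j h = knot i' j' h' ↔ i = i' ∧ j = j' := by
  constructor
  · intro e
    have h1 : i = i' := congrArg Sigma.fst e
    subst h1
    refine ⟨rfl, ?_⟩
    have h2 := eq_of_heq (Sigma.mk.inj e).2
    exact congrArg Fin.val h2
  · rintro ⟨rfl, rfl⟩; rfl

theorem hub_inj {i j : Fin n} : hub k i = hub k j ↔ i = j := by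
  simp [hub, knot_inj]

theorem tip_inj {i j : Fin n} : tip k i = tip k j ↔ i = j := by
  simp only [tip, knot_inj]
  exact ⟨fun h => h.1, fun h => ⟨h, h ▸ rfl⟩⟩

theorem hub_ne_tip {i j : Fin n} : hub k i ≠ tip k j := by
  intro h
  have := (knot_inj.1 h).2
  have := threadLength_pos n k j
  omega

theorem exists_knot (v : SunletVertex n k) : ∃ i j h, v = knot i j h :=
  ⟨v.1, v.2.val, Nat.le_of_lt_succ v.2.isLt, rfl⟩

/-- The next vertex on the way to the cycle, and then around the cycle. -/
def parent (v : SunletVertex n k) : SunletVertex n k :=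
  if v.2.val = 0 then hub k (v.1 + 1) else
    knot v.1 (v.2.val - 1) ((Nat.sub_le _ _).trans (Nat.le_of_lt_succ v.2.isLt))

theorem parent_hub (i : Fin n) : parent (hub k i) = hub k (i + 1) := if_pos rfl

theorem parent_knot (i : Fin n) (j : ℕ) (h : j + 1 ≤ threadLength n k i) :
    parent (knot i (j + 1) h) = knot i j ((Nat.le_succ j).trans h) :=
  if_neg (Nat.succ_ne_zero j)

theorem cycleGraph_adj_iff (hn : 3 ≤ n) (i j : Fin n) :
    (SimpleGraph.cycleGraph n).Adj i j ↔ i + 1 = j ∨ j + 1 = i := by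
  obtain ⟨m, rfl⟩ : ∃ m, n = m + 2 := ⟨n - 2, by omega⟩
  rw [SimpleGraph.cycleGraph_adj, sub_eq_iff_eq_add', sub_eq_iff_eq_add', or_comm]
  have : ∀ a b : Fin (m + 2), (a = b + 1) ↔ (b + 1 = a) := fun a b => eq_comm
  rw [this, this]

theorem add_one_ne_self (hn : 3 ≤ n) (i : Fin n) : i + 1 ≠ i := by
  have := (SimpleGraph.cycleGraph n).irrefl (v := i)
  rw [cycleGraph_adj_iff hn] at this
  exact fun h => this (Or.inl h)

theorem add_two_ne_self (hn : 3 ≤ n) (i : Fin n) : i + 1 + 1 ≠ i := by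
  intro h
  have h1 := congrArg Fin.val h
  have h3 : ((1 : Fin n) : ℕ) = 1 := by
    rw [Fin.val_one', Nat.mod_eq_of_lt (by omega)]
  simp only [Fin.val_add, h3, Nat.mod_add_mod] at h1
  have h2 := i.isLt
  rcases lt_or_ge (i.val + 1 + 1) n with h4 | h4
  · rw [Nat.mod_eq_of_lt h4] at h1; omega
  · rw [Nat.mod_eq_sub_mod h4, Nat.mod_eq_of_lt (by omega)] at h1; omega

theorem adj_iff (hn : 3 ≤ n) (a b : SunletVertex n k) :
    (subdividedSunlet n k).Adj a b ↔ parent a = b ∨ parent b = a := by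
  obtain ⟨i, j, h, rfl⟩ := exists_knot a
  obtain ⟨i', j', h', rfl⟩ := exists_knot b
  change ((j = 0 ∧ j' = 0 ∧ (SimpleGraph.cycleGraph n).Adj i i') ∨
    (i = i' ∧ (j + 1 = j' ∨ j' + 1 = j))) ↔ _
  rw [cycleGraph_adj_iff hn]
  have hp : ∀ (i : Fin n) (j) (h : j ≤ threadLength n k i) (i' : Fin n) (j')
      (h' : j' ≤ threadLength n k i'), parent (knot i j h) = knot i' j' h' ↔
        (j = 0 ∧ j' = 0 ∧ i + 1 = i') ∨ (i = i' ∧ j' + 1 = j) := by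
    intro i j h i' j' h'
    rcases j with _ | j
    · change hub k (i + 1) = _ ↔ _
      simp only [hub, knot_inj]
      constructor
      · rintro ⟨h1, h2⟩; exact Or.inl ⟨trivial, h2.symm, h1⟩
      · rintro (⟨-, h1, h2⟩ | ⟨-, h1⟩)
        · exact ⟨h2, h1.symm⟩
        · omega
    · rw [parent_knot, knot_inj]
      constructor
      · rintro ⟨h1, h2⟩; exact Or.inr ⟨h1, by omega⟩
      · rintro (⟨h1, -⟩ | ⟨h1, h2⟩)
        · omega
        · exact ⟨h1, by omega⟩
  rw [hp, hp]
  constructor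
  · rintro (⟨h1, h2, h3 | h3⟩ | ⟨h1, h2 | h2⟩)
    · exact Or.inl (Or.inl ⟨h1, h2, h3⟩)
    · exact Or.inr (Or.inl ⟨h2, h1, h3⟩)
    · exact Or.inr (Or.inr ⟨h1.symm, h2⟩)
    · exact Or.inl (Or.inr ⟨h1, h2⟩)
  · rintro ((⟨h1, h2, h3⟩ | ⟨h1, h2⟩) | (⟨h1, h2, h3⟩ | ⟨h1, h2⟩))
    · exact Or.inl ⟨h1, h2, Or.inl h3⟩
    · exact Or.inr ⟨h1, Or.inr h2⟩
    · exact Or.inl ⟨h2, h1, Or.inr h3⟩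
    · exact Or.inr ⟨h1.symm, Or.inl h2⟩

/-- A set of vertices that does not contain the cycle induces a forest. -/
theorem sum_degIn_add_two_le (hn : 3 ≤ n) {R : Finset (SunletVertex n k)} (hR : R.Nonempty)
    {i : Fin n} (hi : hub k i ∉ R) :
    ∑ v ∈ R, degIn (subdividedSunlet n k) R v + 2 ≤ 2 * R.card := by
  -- A nonempty set closed under `parent` would run down a thread and then around the whole cycle.
  have hex : ∃ a ∈ R, parent a ∉ R := by
    by_contra! hall
    obtain ⟨v, hv⟩ := hR
    obtain ⟨c, j, h, rfl⟩ := exists_knot v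
    have h0 : hub k c ∈ R := by
      induction j with
      | zero => exact hv
      | succ j ih => exact ih _ (parent_knot c j h ▸ hall _ hv)
    have h1 : ∀ m : ℕ, hub k (c + Fin.ofNat n m) ∈ R := by
      intro m
      induction m with
      | zero =>
        have : c + Fin.ofNat n 0 = c := by ext; simp
        rwa [this]
      | succ m ih =>
        have := hall _ ih
        rw [parent_hub] at this
        convert this using 2
        ext
        simp [Fin.val_add, add_assoc]
    have h2 := h1 (i.val + (n - c.val))
    have : c + Fin.ofNat n (i.val + (n - c.val)) = i := by
      ext
      have := c.isLt
      simp only [Fin.val_add, Fin.ofNat, Nat.add_mod_mod]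
      rw [show c.val + (i.val + (n - c.val)) = i.val + n by omega, Nat.add_mod_right,
        Nat.mod_eq_of_lt i.isLt]
    rw [this] at h2
    exact hi h2
  obtain ⟨a, haR, ha⟩ := hex
  -- Every edge joins a vertex to its parent, so edges inside `R` are charged to their child ends;
  -- the vertex `a` is charged for none.
  have h1 : ∀ v ∈ R, degIn (subdividedSunlet n k) R v ≤
      (if parent v ∈ R then 1 else 0) + ∑ w ∈ R, if parent w = v then 1 else 0 := by
    intro v _
    unfold degIn
    rw [Finset.card_filter, ← Finset.sum_ite_eq R (parent v) (fun _ => 1),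
      ← Finset.sum_add_distrib]
    refine Finset.sum_le_sum fun w _ => ?_
    by_cases hadj : (subdividedSunlet n k).Adj v w
    · rcases (adj_iff hn v w).1 hadj with h | h <;> simp [hadj, h]
    · simp [hadj]
  have h2 := Finset.sum_le_sum h1
  rw [Finset.sum_add_distrib, Finset.sum_comm (s := R) (t := R)] at h2
  simp only [Finset.sum_ite_eq] at h2
  rw [← Finset.card_filter] at h2
  have h3 : (R.filter fun v => parent v ∈ R).card < R.card :=
    Finset.card_lt_card (Finset.filter_ssubset.2 ⟨a, haR, ha⟩)
  omega

theorem degIn_eq_of_neighbors {V : Type*} [DecidableEq V] {G : SimpleGraph V} [DecidableRel G.Adj]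
    {v : V} {N : Finset V} (hN : ∀ w, G.Adj v w ↔ w ∈ N) (S : Finset V) :
    degIn G S v = ∑ w ∈ N, if w ∈ S then 1 else 0 := by
  unfold degIn
  rw [← Finset.card_filter]
  congr 1
  ext w
  simp [hN, and_comm]

theorem degIn_hub (hn : 3 ≤ n) (S : Finset (SunletVertex n k)) (i : Fin n) :
    degIn (subdividedSunlet n k) S (hub k i) = (if hub k (i + 1) ∈ S then 1 else 0) +
      (if hub k (i - 1) ∈ S then 1 else 0) + if root k i ∈ S then 1 else 0 := by
  have h1 : i + 1 ≠ i - 1 := fun h => add_two_ne_self hn (i - 1) (by simp [h])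
  rw [degIn_eq_of_neighbors (N := {hub k (i + 1), hub k (i - 1), root k i})]
  · rw [Finset.sum_insert, Finset.sum_insert, Finset.sum_singleton, add_assoc]
    · simp [hub, root, knot_inj]
    · simp [hub, root, knot_inj, h1]
  · intro w
    obtain ⟨c, j, h, rfl⟩ := exists_knot w
    change ((0 = 0 ∧ j = 0 ∧ (SimpleGraph.cycleGraph n).Adj i c) ∨
      (i = c ∧ (0 + 1 = j ∨ j + 1 = 0))) ↔ _
    simp only [cycleGraph_adj_iff hn, Finset.mem_insert, Finset.mem_singleton, hub, root, knot_inj,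
      eq_sub_iff_add_eq]
    constructor
    · rintro (⟨-, h1, h2 | h2⟩ | ⟨h1, h2⟩)
      · exact Or.inl ⟨h2.symm, h1⟩
      · exact Or.inr (Or.inl ⟨h2, h1⟩)
      · exact Or.inr (Or.inr ⟨h1.symm, by omega⟩)
    · rintro (⟨h1, h2⟩ | ⟨h1, h2⟩ | ⟨h1, h2⟩)
      · exact Or.inl ⟨trivial, h2, Or.inl h1.symm⟩
      · exact Or.inl ⟨trivial, h2, Or.inr h1⟩
      · exact Or.inr ⟨h1.symm, by omega⟩

theorem degIn_knot (S : Finset (SunletVertex n k)) (i : Fin n) (j : ℕ)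
    (h : j + 2 ≤ threadLength n k i) :
    degIn (subdividedSunlet n k) S (knot i (j + 1) (by omega)) =
      (if knot i j (by omega) ∈ S then 1 else 0) + if knot i (j + 2) h ∈ S then 1 else 0 := by
  rw [degIn_eq_of_neighbors (N := {knot i j (by omega), knot i (j + 2) h})]
  · rw [Finset.sum_insert, Finset.sum_singleton]
    simp [knot_inj]
  · intro w
    obtain ⟨c, l, h', rfl⟩ := exists_knot w
    change ((j + 1 = 0 ∧ l = 0 ∧ (SimpleGraph.cycleGraph n).Adj i c) ∨
      (i = c ∧ (j + 1 + 1 = l ∨ l + 1 = j + 1))) ↔ _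
    simp only [Finset.mem_insert, Finset.mem_singleton, knot_inj]
    constructor
    · rintro (⟨h1, -⟩ | ⟨h1, h2⟩)
      · omega
      · rcases h2 with h2 | h2
        · exact Or.inr ⟨h1.symm, by omega⟩
        · exact Or.inl ⟨h1.symm, by omega⟩
    · rintro (⟨h1, h2⟩ | ⟨h1, h2⟩)
      · exact Or.inr ⟨h1.symm, by omega⟩
      · exact Or.inr ⟨h1.symm, by omega⟩

theorem degIn_tip (S : Finset (SunletVertex n k)) (i : Fin n) :
    degIn (subdividedSunlet n k) S (tip k i) =
      if knot i (threadLength n k i - 1) (Nat.sub_le _ _) ∈ S then 1 else 0 := by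
  have hpos := threadLength_pos n k i
  rw [degIn_eq_of_neighbors (N := {knot i (threadLength n k i - 1) (Nat.sub_le _ _)})]
  · rw [Finset.sum_singleton]
  · intro w
    obtain ⟨c, l, h', rfl⟩ := exists_knot w
    change ((threadLength n k i = 0 ∧ l = 0 ∧ (SimpleGraph.cycleGraph n).Adj i c) ∨
      (i = c ∧ (threadLength n k i + 1 = l ∨ l + 1 = threadLength n k i))) ↔ _
    simp only [Finset.mem_singleton, knot_inj]
    constructor
    · rintro (⟨h1, -⟩ | ⟨rfl, h2⟩)
      · omega
      · exact ⟨rfl, by omega⟩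
    · rintro ⟨rfl, h2⟩
      exact Or.inr ⟨rfl, by omega⟩

end Sunlet

/-! ### Shape and deficit of settled positions -/

section Settled

variable {n k : ℕ} [NeZero n] {s : State (SunletVertex n k)}

/-- The load is at least 2, so a single clean neighbour would already let the vertex fire. -/
theorem State.Settled.knot_inner (hs : s.Settled (subdividedSunlet n k)) {i : Fin n} {j : ℕ}
    (h : j + 2 ≤ threadLength n k i) (hv : knot i (j + 1) (by omega) ∈ s.dirty) :
    knot i j (by omega) ∈ s.dirty ∧ knot i (j + 2) h ∈ s.dirty ∧
      s.dirtyDegree (subdividedSunlet n k) (knot i (j + 1) (by omega)) = 2 ∧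
      2 ≤ s.load (subdividedSunlet n k) (knot i (j + 1) (by omega)) ∧
      s.load (subdividedSunlet n k) (knot i (j + 1) (by omega)) < 4 := by
  have h1 := hs.load_lt _ hv
  have h2 := hs.fed _ hv
  rw [State.dirtyDegree_eq] at *
  rw [degIn_knot _ _ _ h] at *
  simp only [Finset.mem_univ, if_true] at h2
  split_ifs at * with ha hb <;> first | omega | exact ⟨ha, hb, by omega⟩

theorem State.Settled.tip_spec (hs : s.Settled (subdividedSunlet n k))
    {i : Fin n} (hv : tip k i ∈ s.dirty) :
    knot i (threadLength n k i - 1) (Nat.sub_le _ _) ∈ s.dirty ∧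
      s.dirtyDegree (subdividedSunlet n k) (tip k i) = 1 ∧ s.load (subdividedSunlet n k) (tip k i) = 1 := by
  have h1 := hs.load_lt _ hv
  have h2 := hs.fed _ hv
  rw [State.dirtyDegree_eq] at *
  rw [degIn_tip] at *
  simp only [Finset.mem_univ, if_true] at h2
  split_ifs at * with ha
  · exact ⟨ha, rfl, by omega⟩
  · omega

theorem State.Settled.knot_pred (hs : s.Settled (subdividedSunlet n k)) {i : Fin n} {j : ℕ}
    (h : j + 1 ≤ threadLength n k i) (hv : knot i (j + 1) h ∈ s.dirty) :
    knot i j (by omega) ∈ s.dirty := by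
  rcases Nat.lt_or_ge (j + 1) (threadLength n k i) with h1 | h1
  · exact (hs.knot_inner h1 hv).1
  · have h2 : knot i (j + 1) h = tip k i := knot_inj.2 ⟨rfl, by omega⟩
    have h3 := (hs.tip_spec (h2 ▸ hv)).1
    convert h3 using 1
    exact knot_inj.2 ⟨rfl, by omega⟩

theorem State.Settled.knot_mem_of_le (hs : s.Settled (subdividedSunlet n k)) {i : Fin n}
    {j l : ℕ} (hjl : j ≤ l)
    (h : l ≤ threadLength n k i) (hv : knot i l h ∈ s.dirty) :
    knot i j (hjl.trans h) ∈ s.dirty := by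
  induction l, hjl using Nat.le_induction with
  | base => exact hv
  | succ l _ ih => exact ih _ (hs.knot_pred h hv)

theorem State.Settled.knot_mem_of_tip (hs : s.Settled (subdividedSunlet n k)) {i : Fin n} {j : ℕ}
    (h : j ≤ threadLength n k i) (hv : tip k i ∈ s.dirty) : knot i j h ∈ s.dirty :=
  hs.knot_mem_of_le h le_rfl hv

theorem State.Settled.tip_mem (hs : s.Settled (subdividedSunlet n k)) {i : Fin n} {j : ℕ}
    (h : j + 1 ≤ threadLength n k i) (hv : knot i (j + 1) h ∈ s.dirty) : tip k i ∈ s.dirty := by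
  obtain ⟨m, hm⟩ := Nat.exists_eq_add_of_le h
  induction m generalizing j with
  | zero =>
    convert hv using 1
    exact knot_inj.2 ⟨rfl, by omega⟩
  | succ m ih =>
    exact ih (j := j + 1) (by omega) (hs.knot_inner (by omega) hv).2.1 (by omega)

/-- Apart from its cycle vertex, a thread is entirely dirty or entirely clean. -/
theorem State.Settled.root_mem_iff (hs : s.Settled (subdividedSunlet n k)) {i : Fin n} :
    root k i ∈ s.dirty ↔ tip k i ∈ s.dirty :=
  ⟨hs.tip_mem _, hs.knot_mem_of_tip _⟩

theorem State.Settled.exists_hub (hs : s.Settled (subdividedSunlet n k)) (h : s.dirty.Nonempty) :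
    ∃ i, hub k i ∈ s.dirty := by
  obtain ⟨v, hv⟩ := h
  obtain ⟨i, j, h, rfl⟩ := exists_knot v
  exact ⟨i, hs.knot_mem_of_le (Nat.zero_le _) h hv⟩

theorem State.Settled.dirtyDegree_hub (hs : s.Settled (subdividedSunlet n k)) (hn : 3 ≤ n)
    (i : Fin n) :
    s.dirtyDegree (subdividedSunlet n k) (hub k i) = (if hub k (i + 1) ∈ s.dirty then 1 else 0) +
      (if hub k (i - 1) ∈ s.dirty then 1 else 0) + if tip k i ∈ s.dirty then 1 else 0 := by
  rw [State.dirtyDegree_eq, degIn_hub hn]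
  simp only [hs.root_mem_iff]

theorem State.Settled.three_le_load (hs : s.Settled (subdividedSunlet n k)) (hn : 3 ≤ n) {i : Fin n}
    (h : hub k i ∈ s.dirty) : 3 ≤ s.load (subdividedSunlet n k) (hub k i) := by
  have := hs.fed _ h
  rw [degIn_hub hn] at this
  simpa using this

theorem State.Settled.two_le_dirtyDegree_hub (hs : s.Settled (subdividedSunlet n k)) (hn : 3 ≤ n)
    {i : Fin n}
    (h : hub k i ∈ s.dirty) : 2 ≤ s.dirtyDegree (subdividedSunlet n k) (hub k i) := by
  have := hs.three_le_load hn h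
  have := hs.load_lt _ h
  omega

/-- The contribution of a vertex to the deficit. -/
def State.need (s : State (SunletVertex n k)) (v : SunletVertex n k) : ℤ :=
  if v ∈ s.dirty then (s.dirtyDegree (subdividedSunlet n k) v : ℤ) - 2 * (s.load (subdividedSunlet n k) v / 2 : ℕ)
  else 0

theorem sum_eq_ends {m : ℕ} (hm : 0 < m) (f : Fin (m + 1) → ℤ)
    (hf : ∀ j : Fin (m + 1), j.val ≠ 0 → j.val ≠ m → f j = 0) :
    ∑ j, f j = f 0 + f (Fin.last m) := by
  obtain ⟨l, rfl⟩ : ∃ l, m = l + 1 := ⟨m - 1, by omega⟩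
  rw [Fin.sum_univ_succ, Fin.sum_univ_castSucc, Fin.succ_last]
  rw [Finset.sum_eq_zero fun j _ => hf _ (by simp) (by simp; omega), zero_add]

/-- Inner thread vertices have dirty degree 2 and load 2 or 3, hence contribute 0. -/
theorem State.Settled.deficit_eq (hs : s.Settled (subdividedSunlet n k)) :
    s.deficit (subdividedSunlet n k) = ∑ i, (s.need (hub k i) + s.need (tip k i)) := by
  have h1 : s.deficit (subdividedSunlet n k) = ∑ v, s.need v := by
    unfold State.deficit State.need
    rw [Finset.sum_ite_mem, Finset.univ_inter]
  rw [h1, Fintype.sum_sigma]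
  refine Finset.sum_congr rfl fun i _ => sum_eq_ends (threadLength_pos n k i) _ ?_
  rintro ⟨j, hj⟩ h0 hl
  simp only at h0 hl
  obtain ⟨j, rfl⟩ := Nat.exists_eq_succ_of_ne_zero h0
  change s.need (knot i (j + 1) (by omega)) = 0
  unfold State.need
  split_ifs with h
  · obtain ⟨-, -, h3, h4, h5⟩ := hs.knot_inner (by omega) h
    omega
  · rfl

theorem State.Settled.need_tip (hs : s.Settled (subdividedSunlet n k)) (i : Fin n) :
    s.need (tip k i) = if tip k i ∈ s.dirty then 1 else 0 := by
  unfold State.need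
  split_ifs with h
  · obtain ⟨-, h1, h2⟩ := hs.tip_spec h
    rw [h1, h2]; rfl
  · rfl

/-- The cycle vertex contributes -1 only when its load is 4 or 5; its dirty degree is then 3, and
its dirty tip makes up the loss. -/
theorem State.Settled.need_nonneg (hs : s.Settled (subdividedSunlet n k)) (hn : 3 ≤ n) (i : Fin n) :
    0 ≤ s.need (hub k i) + s.need (tip k i) := by
  rw [hs.need_tip]
  unfold State.need
  split_ifs with h1 h2 h2
  all_goals try omega
  all_goals
    have h3 := hs.three_le_load hn h1
    have h4 := hs.load_lt _ h1
    have h5 := hs.dirtyDegree_hub hn i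
    simp only [h2, if_true, if_false] at h5
    split_ifs at h5 <;> omega

theorem State.Settled.need_hub_le (hs : s.Settled (subdividedSunlet n k)) (hn : 3 ≤ n) (i : Fin n) :
    s.need (hub k i) + s.need (tip k i) ≤ if tip k i ∈ s.dirty then 2 else 0 := by
  rw [hs.need_tip]
  unfold State.need
  by_cases h1 : hub k i ∈ s.dirty
  · have h3 := hs.three_le_load hn h1
    have h5 := hs.dirtyDegree_hub hn i
    rw [if_pos h1]
    split_ifs at * <;> omega
  · rw [if_neg h1]
    split_ifs <;> omega

/-- An end of an arc of dirty cycle vertices. -/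
theorem State.Settled.arc_end (hs : s.Settled (subdividedSunlet n k)) (hn : 3 ≤ n) {i : Fin n}
    (h : hub k i ∈ s.dirty) (h' : hub k (i + 1) ∉ s.dirty ∨ hub k (i - 1) ∉ s.dirty) :
    tip k i ∈ s.dirty ∧ 1 ≤ s.need (hub k i) + s.need (tip k i) := by
  have h1 := hs.three_le_load hn h
  have h2 := hs.load_lt _ h
  have h3 := hs.dirtyDegree_hub hn i
  have h4 : tip k i ∈ s.dirty := by
    by_contra h4
    rw [if_neg h4] at h3
    rcases h' with h' | h' <;> rw [if_neg h'] at h3 <;> split_ifs at h3 <;> omega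
  refine ⟨h4, ?_⟩
  rw [hs.need_tip, if_pos h4]
  unfold State.need
  rw [if_pos h]
  rw [if_pos h4] at h3
  rcases h' with h' | h' <;> rw [if_neg h'] at h3 <;> split_ifs at h3 <;> omega

theorem exists_step_out (P : Fin n → Prop) (σ : Fin n → Fin n)
    (hσ : ∀ i j, ∃ m : ℕ, σ^[m] i = j) (h1 : ∃ i, P i) (h2 : ∃ i, ¬ P i) :
    ∃ i, P i ∧ ¬ P (σ i) := by
  obtain ⟨i, hi⟩ := h1
  obtain ⟨j, hj⟩ := h2
  by_contra! hall
  obtain ⟨m, rfl⟩ := hσ i j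
  apply hj
  clear hj
  induction m with
  | zero => exact hi
  | succ m ih => rw [Function.iterate_succ_apply']; exact hall _ ih

theorem iterate_add_one (m : ℕ) (i : Fin n) : ((· + 1)^[m] i) = i + Fin.ofNat n m := by
  induction m with
  | zero => ext; simp
  | succ m ih =>
    rw [Function.iterate_succ_apply', ih]
    ext
    simp [Fin.val_add, add_assoc]

theorem exists_iterate_add_one (i j : Fin n) : ∃ m : ℕ, (· + 1)^[m] i = j := by
  refine ⟨(j - i).val, ?_⟩
  rw [iterate_add_one, Fin.ofNat_val_eq_self]
  simp

theorem exists_iterate_sub_one (i j : Fin n) : ∃ m : ℕ, (· - 1)^[m] i = j := by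
  obtain ⟨m, hm⟩ := exists_iterate_add_one j i
  refine ⟨m, ?_⟩
  rw [← hm]
  exact Function.LeftInverse.iterate (fun a => by simp) m j

/-- An arc of dirty cycle vertices has two ends. -/
theorem State.Settled.exists_arc_ends (hs : s.Settled (subdividedSunlet n k)) (hn : 3 ≤ n)
    (hne : s.dirty.Nonempty) (hc : ∃ i, hub k i ∉ s.dirty) :
    ∃ i j, i ≠ j ∧ (hub k i ∈ s.dirty ∧ hub k (i + 1) ∉ s.dirty) ∧
      (hub k j ∈ s.dirty ∧ hub k (j - 1) ∉ s.dirty) := by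
  obtain ⟨i, hi⟩ := exists_step_out _ _ exists_iterate_add_one (hs.exists_hub hne) hc
  obtain ⟨j, hj⟩ := exists_step_out _ _ exists_iterate_sub_one (hs.exists_hub hne) hc
  refine ⟨i, j, ?_, hi, hj⟩
  rintro rfl
  -- An arc consisting of one vertex would leave it with dirty degree at most 1.
  have h1 := hs.two_le_dirtyDegree_hub hn hi.1
  rw [hs.dirtyDegree_hub hn, if_neg hi.2, if_neg hj.2] at h1
  split_ifs at h1 <;> omega

theorem State.Settled.two_le_deficit (hs : s.Settled (subdividedSunlet n k)) (hn : 3 ≤ n)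
    (hne : s.dirty.Nonempty) (hc : ∃ i, hub k i ∉ s.dirty) : 2 ≤ s.deficit (subdividedSunlet n k) := by
  obtain ⟨i, j, hij, hi, hj⟩ := hs.exists_arc_ends hn hne hc
  have h1 := (hs.arc_end hn hi.1 (Or.inl hi.2)).2
  have h2 := (hs.arc_end hn hj.1 (Or.inr hj.2)).2
  rw [hs.deficit_eq]
  have h3 := Finset.sum_le_sum_of_subset_of_nonneg (Finset.subset_univ {i, j})
    fun c _ _ => hs.need_nonneg hn c
  rw [Finset.sum_pair hij] at h3
  linarith

/-- If some cycle vertex is clean and at most one thread is dirty, then everything is clean. -/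
theorem State.Settled.dirty_eq_empty (hs : s.Settled (subdividedSunlet n k)) (hn : 3 ≤ n)
    (hc : ∃ i, hub k i ∉ s.dirty)
    (ht : ∀ i j, tip k i ∈ s.dirty → tip k j ∈ s.dirty → i = j) : s.dirty = ∅ := by
  by_contra h
  obtain ⟨i, j, hij, hi, hj⟩ := hs.exists_arc_ends hn (Finset.nonempty_iff_ne_empty.2 h) hc
  exact hij (ht i j (hs.arc_end hn hi.1 (Or.inl hi.2)).1 (hs.arc_end hn hj.1 (Or.inr hj.2)).1)

end Settled

/-! ### The starting position and the brush number -/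

section Initial

variable {n k : ℕ} [NeZero n]

theorem fed_initial (f : SunletVertex n k → ℕ) :
    (initial f).Fed (subdividedSunlet n k) := fun _ _ => Nat.le_add_left _ _

theorem settled_initial (hn : 3 ≤ n) :
    (initial fun _ : SunletVertex n k => 0).Settled (subdividedSunlet n k) := by
  refine ⟨fun v _ => ?_, fed_initial _⟩
  have h : (initial fun _ : SunletVertex n k => 0).load (subdividedSunlet n k) v =
    degIn (subdividedSunlet n k) Finset.univ v := Nat.zero_add _
  rw [h, State.dirtyDegree_eq]
  change _ < 2 * degIn _ Finset.univ v
  obtain ⟨i, j, hj, rfl⟩ := exists_knot v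
  have : 0 < degIn (subdividedSunlet n k) Finset.univ (knot i j hj) := by
    rcases j with _ | j
    · change 0 < degIn _ _ (hub k i)
      rw [degIn_hub hn]; simp
    · refine Finset.card_pos.2 ⟨knot i j (by omega), Finset.mem_filter.2 ⟨Finset.mem_univ _, ?_⟩⟩
      exact (adj_iff hn _ _).2 (Or.inl (parent_knot i j hj))
  omega

theorem deficit_initial (hn : 3 ≤ n) :
    (initial fun _ : SunletVertex n k => 0).deficit (subdividedSunlet n k) = 2 * n := by
  have hs := settled_initial (k := k) hn
  rw [hs.deficit_eq]
  have : ∀ i, (initial fun _ : SunletVertex n k => 0).need (hub k i) +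
      (initial fun _ : SunletVertex n k => 0).need (tip k i) = 2 := by
    intro i
    have hd := hs.dirtyDegree_hub hn i
    have hl : (initial fun _ : SunletVertex n k => 0).load (subdividedSunlet n k) (hub k i) =
      (initial fun _ : SunletVertex n k => 0).dirtyDegree (subdividedSunlet n k) (hub k i) :=
      Nat.zero_add _
    rw [hs.need_tip]
    unfold State.need
    rw [hl, hd]
    simp [initial]
  rw [Finset.sum_congr rfl fun i _ => this i]
  simp [mul_comm]

theorem total_initial (f : SunletVertex n k → ℕ) : (initial f).total = ∑ v, f v := rfl

/-- Each brush raises a capacity by at most 1. -/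
theorem le_deficit_initial (hn : 3 ≤ n) (f : SunletVertex n k → ℕ) :
    2 * (n : ℤ) - 2 * (∑ v, f v : ℕ) ≤ (initial f).deficit (subdividedSunlet n k) := by
  rw [← deficit_initial (k := k) hn]
  unfold State.deficit
  rw [Nat.cast_sum, Finset.mul_sum]
  change ∑ v, _ - _ ≤ ∑ v, _
  rw [← Finset.sum_sub_distrib]
  refine Finset.sum_le_sum fun v _ => ?_
  have h1 : ∀ f : SunletVertex n k → ℕ, (initial f).load (subdividedSunlet n k) v =
    f v + degIn (subdividedSunlet n k) Finset.univ v := fun _ => rfl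
  have h2 : ∀ f : SunletVertex n k → ℕ, (initial f).dirtyDegree (subdividedSunlet n k) v =
    degIn (subdividedSunlet n k) Finset.univ v := fun _ => rfl
  rw [h1, h1, h2, h2]
  omega

theorem le_of_cleanedBy (hn : 3 ≤ n) {f : SunletVertex n k → ℕ}
    (h : CleanedBy (subdividedSunlet n k) f) : n ≤ ∑ v, f v := by
  obtain ⟨t, ht, hte⟩ := h
  have h1 := (Reaches.spec _ ht).2.2.2
  have h2 := le_deficit_initial hn f
  have h3 : t.deficit (subdividedSunlet n k) = 0 := by unfold State.deficit; rw [hte]; rfl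
  omega

theorem exists_cleanedBy (hn : 3 ≤ n) :
    ∃ f : SunletVertex n k → ℕ, CleanedBy (subdividedSunlet n k) f ∧ ∑ v, f v = n := by
  have h10 : (1 : Fin n) ≠ 0 := by simpa using add_one_ne_self hn 0
  -- One brush on each tip but one cleans those threads, and one on a cycle vertex with a clean
  -- thread lets it fire. The remaining thread cannot support both ends of a dirty arc.
  let A : Finset (SunletVertex n k) := insert (hub k 0) ((Finset.univ.erase 1).image (tip k))
  have hA : A.card = n := by
    rw [Finset.card_insert_of_notMem, Finset.card_image_of_injective _ fun i j h => tip_inj.1 h,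
      Finset.card_erase_of_mem (Finset.mem_univ _), Finset.card_fin]
    · omega
    · intro h
      obtain ⟨i, -, h⟩ := Finset.mem_image.1 h
      exact hub_ne_tip h.symm
  refine ⟨fun v => if v ∈ A then 1 else 0, ?_, ?_⟩
  · obtain ⟨t, ht⟩ := exists_stabilizesTo (subdividedSunlet n k)
      (initial fun v => if v ∈ A then 1 else 0)
    have hts := ht.settled _ (fed_initial _)
    have hload : ∀ v ∈ t.dirty, t.load (subdividedSunlet n k) v =
        (if v ∈ A then 1 else 0) + degIn (subdividedSunlet n k) Finset.univ v :=
      fun v hv => (Reaches.spec _ ht.1).2.1 v hv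
    have htip : ∀ i, i ≠ 1 → tip k i ∉ t.dirty := by
      intro i hi h
      have h1 := (hts.tip_spec h).2.2
      have h2 := hload _ h
      have h3 : tip k i ∈ A := Finset.mem_insert_of_mem (Finset.mem_image_of_mem _ (by simpa))
      rw [if_pos h3, degIn_tip] at h2
      simp at h2
      omega
    refine ⟨t, ht.1, hts.dirty_eq_empty hn ⟨0, fun h => ?_⟩ fun i j hi hj => ?_⟩
    · have h1 := hload _ h
      have h2 := hts.load_lt _ h
      rw [if_pos (Finset.mem_insert_self _ _), degIn_hub hn] at h1
      rw [hts.dirtyDegree_hub hn, if_neg (htip 0 h10.symm)] at h2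
      simp at h1
      split_ifs at h2 <;> omega
    · rw [show i = 1 by by_contra h; exact htip i h hi, show j = 1 by by_contra h; exact htip j h hj]
  · rw [Finset.sum_ite_mem, Finset.univ_inter, ← Finset.card_eq_sum_ones, hA]

theorem brushNumber_subdividedSunlet (hn : 3 ≤ n) :
    brushNumber (subdividedSunlet n k) = n := by
  apply le_antisymm
  · exact Nat.sInf_le (exists_cleanedBy hn)
  · obtain ⟨f, hf, hsum⟩ := Nat.sInf_mem (s := {m | ∃ f : SunletVertex n k → ℕ,
      CleanedBy (subdividedSunlet n k) f ∧ ∑ v, f v = m}) ⟨n, exists_cleanedBy hn⟩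
    unfold brushNumber
    rw [← hsum]
    exact le_of_cleanedBy hn hf

end Initial

/-! ### Max's strategy: wasting brushes inside long threads -/

section Lower

variable {n k : ℕ} [NeZero n] {s t : State (SunletVertex n k)}

/-- The dirty vertices of degree two on which an odd number of brushes has been placed. -/
def State.oddInner (s : State (SunletVertex n k)) : Finset (SunletVertex n k) :=
  s.dirty.filter fun v => (0 < v.2.val ∧ v.2.val < threadLength n k v.1) ∧
    s.load (subdividedSunlet n k) v % 2 = 1

/-- A new odd inner vertex costs a wasted brush, so their number never exceeds the waste. -/
theorem Turn.card_oddInner_le {v : SunletVertex n k} (h : Turn (subdividedSunlet n k) s v t) :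
    t.oddInner.card + s.load (subdividedSunlet n k) v % 2 ≤ s.oddInner.card + 1 := by
  have hsub : ∀ w ∈ t.oddInner, w ≠ v → w ∈ s.oddInner := by
    intro w hw hne
    obtain ⟨h1, h2, h3⟩ := Finset.mem_filter.1 hw
    rw [h.load w h1, if_neg hne] at h3
    exact Finset.mem_filter.2 ⟨h.subset h1, h2, h3⟩
  rcases Nat.mod_two_eq_zero_or_one (s.load (subdividedSunlet n k) v) with he | ho
  · have : t.oddInner ⊆ insert v s.oddInner := fun w hw => by
      by_cases hne : w = v
      · exact hne ▸ Finset.mem_insert_self _ _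
      · exact Finset.mem_insert_of_mem (hsub w hw hne)
    have := (Finset.card_le_card this).trans (Finset.card_insert_le _ _)
    omega
  · have : t.oddInner ⊆ s.oddInner := fun w hw => by
      refine hsub w hw ?_
      rintro rfl
      obtain ⟨h1, h2, h3⟩ := Finset.mem_filter.1 hw
      rw [h.load w h1, if_pos rfl] at h3
      omega
    have := Finset.card_le_card this
    omega

/-- As long as a long thread is dirty and few brushes have been wasted, Max can waste one more. -/
theorem State.Settled.exists_wasting (hs : s.Settled (subdividedSunlet n k)) (hn : 3 ≤ n)
    (hk : k ≤ n) (hw : s.oddInner.card < n)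
    (hQ : 2 * (n : ℤ) - 2 * k < s.deficit (subdividedSunlet n k)) :
    ∃ v ∈ s.dirty, s.load (subdividedSunlet n k) v % 2 = 0 := by
  by_contra! hodd
  have hclean : ∀ i : Fin n, i.val < k → tip k i ∉ s.dirty := by
    intro i hi h
    have hL := threadLength_of_lt hi
    have hcard : (Finset.univ.image fun j : Fin n =>
        (knot i (j.val + 1) (by omega) : SunletVertex n k)).card = n := by
      rw [Finset.card_image_of_injective _ fun a b hab => ?_, Finset.card_fin]
      have := (knot_inj.1 hab).2
      exact Fin.ext (by omega)
    have hsub : (Finset.univ.image fun j : Fin n =>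
        (knot i (j.val + 1) (by omega) : SunletVertex n k)) ⊆ s.oddInner := by
      intro v hv
      obtain ⟨j, -, rfl⟩ := Finset.mem_image.1 hv
      have hm := hs.knot_mem_of_tip (j := j.val + 1) (by omega) h
      refine Finset.mem_filter.2 ⟨hm, ⟨Nat.succ_pos _, ?_⟩, ?_⟩
      · change j.val + 1 < threadLength n k i
        omega
      · have := hodd _ hm
        omega
    have := Finset.card_le_card hsub
    omega
  -- With all long threads clean, only the `n - k` short ones contribute, at most 2 each.
  have h1 : s.deficit (subdividedSunlet n k) ≤ ∑ i : Fin n, if i.val < k then (0 : ℤ) else 2 := by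
    rw [hs.deficit_eq]
    refine Finset.sum_le_sum fun i _ => (hs.need_hub_le hn i).trans ?_
    split_ifs with h2 h3 <;> first | exact absurd h2 (hclean i h3) | norm_num
  have h2 : ∑ i : Fin n, (if i.val < k then (0 : ℤ) else 2) = 2 * n - 2 * k := by
    rw [Fin.sum_univ_eq_sum_range fun i => if i < k then (0 : ℤ) else 2]
    obtain ⟨m, rfl⟩ := Nat.exists_eq_add_of_le hk
    rw [Finset.sum_range_add, Finset.sum_eq_zero fun i hi => if_pos (Finset.mem_range.1 hi)]
    simp
    ring
  omega

/-- The first inequality says that the waste is at least the number of odd inner vertices. The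
disjunction says that either the waste has reached `k - 1`, or at least half of the brushes were
wasted (up to the one Min has just placed). An empty position has deficit 0, and either alternative
then gives `n + k ≤ total + 1`. -/
theorem le_add_of_endsWithin (hn : 3 ≤ n) (hk : k ≤ n) (T : ℕ) :
    (∀ s : State (SunletVertex n k), s.Settled (subdividedSunlet n k) →
      2 * (n : ℤ) + 2 * s.oddInner.card ≤ s.deficit (subdividedSunlet n k) + 2 * s.total →
      (2 * (n : ℤ) + 2 * k ≤ s.deficit (subdividedSunlet n k) + 2 * s.total + 2 ∨
        2 * (n : ℤ) ≤ s.deficit (subdividedSunlet n k) + s.total) →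
      EndsWithin (subdividedSunlet n k) T .min s → n + k ≤ s.total + T + 1) ∧
    (∀ s : State (SunletVertex n k), s.Settled (subdividedSunlet n k) →
      2 * (n : ℤ) + 2 * s.oddInner.card ≤ s.deficit (subdividedSunlet n k) + 2 * s.total →
      (2 * (n : ℤ) + 2 * k ≤ s.deficit (subdividedSunlet n k) + 2 * s.total + 2 ∨
        2 * (n : ℤ) ≤ s.deficit (subdividedSunlet n k) + s.total + 1) →
      EndsWithin (subdividedSunlet n k) T .max s → n + k ≤ s.total + T + 1) := by
  have hend : ∀ s : State (SunletVertex n k), s.dirty = ∅ →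
      s.deficit (subdividedSunlet n k) = 0 := by
    intro s h
    unfold State.deficit
    rw [h]
    rfl
  have hcard : ∀ {s t : State (SunletVertex n k)} {v}, Turn (subdividedSunlet n k) s v t →
      2 * (n : ℤ) + 2 * s.oddInner.card ≤ s.deficit (subdividedSunlet n k) + 2 * s.total →
      2 * (n : ℤ) + 2 * t.oddInner.card ≤ t.deficit (subdividedSunlet n k) + 2 * t.total := by
    intro s t v hT h
    have h1 := hT.card_oddInner_le
    have h2 := hT.le_deficit
    rw [hT.total]
    omega
  induction T with
  | zero =>
    constructor <;>
    · intro s _ _ h2 h3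
      rw [hend s h3] at h2
      omega
  | succ T ih =>
    constructor
    · rintro s hs h1 h2 (h3 | ⟨v, hv, h3⟩)
      · rw [hend s h3] at h2
        omega
      obtain ⟨t, ht⟩ := exists_stabilizesTo (subdividedSunlet n k) (s.place v)
      have hT := ht.turn _ hs hv
      have h4 := hT.le_deficit
      have h5 := ih.2 t hT.settled (hcard hT h1) (by rw [hT.total]; omega) (h3 t ht)
      rw [hT.total] at h5
      omega
    · rintro s hs h1 h2 (h3 | h3)
      · rw [hend s h3] at h2
        omega
      by_cases hne : s.dirty = ∅
      · rw [hend s hne] at h2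
        omega
      have key : ∃ v ∈ s.dirty,
          2 * (n : ℤ) + 2 * k ≤ s.deficit (subdividedSunlet n k) + 2 * s.total + 2 ∨
            s.load (subdividedSunlet n k) v % 2 = 0 := by
        by_cases hdone : 2 * (n : ℤ) + 2 * k ≤ s.deficit (subdividedSunlet n k) + 2 * s.total + 2
        · obtain ⟨v, hv⟩ := Finset.nonempty_iff_ne_empty.2 hne
          exact ⟨v, hv, Or.inl hdone⟩
        -- With waste below `k - 1`, the turn count forces `total < 2 * k`, so the deficit still
        -- exceeds `2 * n - 2 * k`.
        · obtain ⟨v, hv, hv'⟩ := hs.exists_wasting hn hk (by omega) (by omega)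
          exact ⟨v, hv, Or.inr hv'⟩
      obtain ⟨v, hv, hkey⟩ := key
      obtain ⟨t, ht⟩ := exists_stabilizesTo (subdividedSunlet n k) (s.place v)
      have hT := ht.turn _ hs hv
      have h4 := hT.le_deficit
      have h5 := ih.1 t hT.settled (hcard hT h1) (by rw [hT.total]; omega) (h3 v hv t ht)
      rw [hT.total] at h5
      omega

theorem oddInner_initial : (initial fun _ : SunletVertex n k => 0).oddInner = ∅ := by
  refine Finset.filter_eq_empty_iff.2 fun v _ => ?_
  rintro ⟨⟨h1, h2⟩, h3⟩
  obtain ⟨i, j, hj, rfl⟩ := exists_knot v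
  change 0 < j at h1
  change j < threadLength n k i at h2
  obtain ⟨j, rfl⟩ := Nat.exists_eq_succ_of_ne_zero h1.ne'
  have h4 : (initial fun _ : SunletVertex n k => 0).load (subdividedSunlet n k) (knot i (j + 1) hj)
    = degIn (subdividedSunlet n k) Finset.univ (knot i (j + 1) hj) := Nat.zero_add _
  rw [h4, degIn_knot _ _ _ h2] at h3
  simp at h3

theorem le_of_endsWithin_initial (hn : 3 ≤ n) (hk : k ≤ n) {T : ℕ}
    (h : EndsWithin (subdividedSunlet n k) T .min (initial fun _ => 0)) : n + k - 1 ≤ T := by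
  have h0 : (initial fun _ : SunletVertex n k => 0).total = 0 := by
    rw [total_initial]; simp
  have := (le_add_of_endsWithin hn hk T).1 _ (settled_initial hn)
    (by rw [deficit_initial hn, oddInner_initial]; simp [h0])
    (by rw [deficit_initial hn]; right; simp [h0]) h
  omega

end Lower

/-! ### Min's strategy: controlling the cost -/

section Upper

variable {n k : ℕ} [NeZero n] {s t : State (SunletVertex n k)}

/-- The cycle vertices on which Max may waste a brush. -/
def State.evenHubs (s : State (SunletVertex n k)) : Finset (Fin n) :=
  Finset.univ.filter fun i => hub k i ∈ s.dirty ∧ s.load (subdividedSunlet n k) (hub k i) % 2 = 0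

/-- The long threads that are dirty. -/
def State.longThreads (s : State (SunletVertex n k)) : Finset (Fin n) :=
  Finset.univ.filter fun i => i.val < k ∧ tip k i ∈ s.dirty

theorem State.mem_evenHubs {i : Fin n} : i ∈ s.evenHubs ↔
    hub k i ∈ s.dirty ∧ s.load (subdividedSunlet n k) (hub k i) % 2 = 0 := by
  simp [State.evenHubs]

theorem State.mem_longThreads {i : Fin n} :
    i ∈ s.longThreads ↔ i.val < k ∧ tip k i ∈ s.dirty := by
  simp [State.longThreads]

/-- A settled position that is not clean has a dirty cycle vertex, so the vertices just fired miss
part of the cycle and induce a forest. -/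
theorem Turn.deficit_le_of_nonempty (hn : 3 ≤ n) {v : SunletVertex n k}
    (h : Turn (subdividedSunlet n k) s v t) (hs : s.Settled (subdividedSunlet n k))
    (hne : t.dirty.Nonempty) : t.deficit (subdividedSunlet n k) ≤
      s.deficit (subdividedSunlet n k) - 2 * (s.load (subdividedSunlet n k) v % 2 : ℕ) := by
  refine h.deficit_le _ hs ?_
  rcases Finset.eq_empty_or_nonempty (s.dirty \ t.dirty) with h0 | h0
  · exact Or.inr h0
  · obtain ⟨i, hi⟩ := h.settled.exists_hub hne
    exact Or.inl (sum_degIn_add_two_le hn h0 (i := i) (by simp [hi]))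

theorem Turn.longThreads_subset {v : SunletVertex n k} (h : Turn (subdividedSunlet n k) s v t) :
    t.longThreads ⊆ s.longThreads := fun i hi => by
  rw [State.mem_longThreads] at *
  exact ⟨hi.1, h.subset hi.2⟩

theorem Turn.card_longThreads_le {v : SunletVertex n k}
    (h : Turn (subdividedSunlet n k) s v t) : t.longThreads.card ≤ s.longThreads.card :=
  Finset.card_le_card h.longThreads_subset

theorem Turn.mem_evenHubs_of_ne {v : SunletVertex n k} (h : Turn (subdividedSunlet n k) s v t)
    {i : Fin n} (hi : i ∈ t.evenHubs) (hne : hub k i ≠ v) : i ∈ s.evenHubs := by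
  rw [State.mem_evenHubs] at *
  have := h.load _ hi.1
  rw [if_neg hne] at this
  exact ⟨h.subset hi.1, by omega⟩

theorem Turn.evenHubs_subset {v : SunletVertex n k} (h : Turn (subdividedSunlet n k) s v t)
    (hv : ∀ i, hub k i = v → hub k i ∉ t.dirty) : t.evenHubs ⊆ s.evenHubs := fun i hi =>
  h.mem_evenHubs_of_ne hi fun he => hv i he (State.mem_evenHubs.1 hi).1

/-- The brush flips the parity at `i`: an even cycle vertex is used up, while an odd one may become
even if it stays dirty. -/
theorem Turn.card_evenHubs_hub_le {i : Fin n} (h : Turn (subdividedSunlet n k) s (hub k i) t)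
    (hi : hub k i ∈ s.dirty) :
    t.evenHubs.card + 1 ≤ s.evenHubs.card + 2 * (s.load (subdividedSunlet n k) (hub k i) % 2) := by
  rcases Nat.mod_two_eq_zero_or_one (s.load (subdividedSunlet n k) (hub k i)) with he | ho
  · have h1 : i ∈ s.evenHubs := State.mem_evenHubs.2 ⟨hi, he⟩
    have h2 : t.evenHubs ⊆ s.evenHubs.erase i := fun j hj => by
      have hne : j ≠ i := by
        rintro rfl
        have h3 := State.mem_evenHubs.1 hj
        have h4 := h.load _ h3.1
        rw [if_pos rfl] at h4
        omega
      exact Finset.mem_erase.2 ⟨hne, h.mem_evenHubs_of_ne hj fun e => hne (hub_inj.1 e)⟩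
    have h3 := Finset.card_le_card h2
    have h4 := Finset.card_erase_add_one h1
    omega
  · have h2 : t.evenHubs ⊆ insert i s.evenHubs := fun j hj => by
      by_cases hne : j = i
      · exact hne ▸ Finset.mem_insert_self _ _
      · exact Finset.mem_insert_of_mem (h.mem_evenHubs_of_ne hj fun e => hne (hub_inj.1 e))
    have := (Finset.card_le_card h2).trans (Finset.card_insert_le _ _)
    omega

/-- An upper bound for twice the final number of brushes under good play by Min. -/
def State.cost (s : State (SunletVertex n k)) : ℤ :=
  s.deficit (subdividedSunlet n k) + 2 * (s.evenHubs.card + s.longThreads.card + s.total : ℕ)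

/-- The positions with Max to move that Min's strategy allows. -/
structure State.MaxSafe (s : State (SunletVertex n k)) : Prop where
  settled : s.Settled (subdividedSunlet n k)
  total_le : s.total + 1 ≤ n + k
  cost_le : s.dirty.Nonempty → s.cost + 2 ≤ 2 * n + 2 * k
  of_hubs : s.dirty.Nonempty → (∀ i, hub k i ∈ s.dirty) →
    s.total + 2 * s.longThreads.card + 1 ≤ 2 * k ∧ (k = n → s.total + 3 ≤ 2 * n)

/-- The positions with Min to move that Min's strategy allows. -/
structure State.MinSafe (s : State (SunletVertex n k)) : Prop where
  settled : s.Settled (subdividedSunlet n k)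
  total_le : s.total + 1 ≤ n + k
  cost_le : s.dirty.Nonempty → s.cost ≤ 2 * n + 2 * k
  cost_le' : s.dirty.Nonempty → s.evenHubs.card + s.longThreads.card = 0 →
    s.cost + 2 ≤ 2 * n + 2 * k
  of_hubs : s.dirty.Nonempty → (∀ i, hub k i ∈ s.dirty) →
    s.total + 2 * s.longThreads.card ≤ 2 * k ∧ (k = n → s.total + 2 ≤ 2 * n)

theorem State.MaxSafe.total_lt (h : s.MaxSafe) (hn : 3 ≤ n) (hk : k ≤ n) (hne : s.dirty.Nonempty) :
    s.total + 2 ≤ n + k := by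
  by_cases hc : ∀ i, hub k i ∈ s.dirty
  · obtain ⟨h1, h2⟩ := h.of_hubs hne hc
    rcases hk.eq_or_lt with h3 | h3
    · have := h2 h3
      omega
    · omega
  · push Not at hc
    have h1 := h.settled.two_le_deficit hn hne hc
    have h2 := h.cost_le hne
    unfold State.cost at h2
    omega

/-- A clean cycle vertex forces deficit at least 2, and the cost bounds suffice. With the cycle all
dirty, only `total ≤ 2 * k` is available; this suffices for `k ≤ n - 2`, while `k = n` has its own
clause. -/
theorem State.MinSafe.total_lt (h : s.MinSafe) (hn : 3 ≤ n) (hk : k ≤ n) (hk' : k ≠ n - 1)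
    (hne : s.dirty.Nonempty) : s.total + 2 ≤ n + k := by
  by_cases hc : ∀ i, hub k i ∈ s.dirty
  · obtain ⟨h1, h2⟩ := h.of_hubs hne hc
    rcases hk.eq_or_lt with h3 | h3
    · have := h2 h3
      omega
    · omega
  · push Not at hc
    have h1 := h.settled.two_le_deficit hn hne hc
    have h2 := h.cost_le hne
    have h3 := h.cost_le' hne
    unfold State.cost at h2 h3
    omega

/-- The cost rises, by 2, only for a brush on an odd cycle vertex that becomes even or on an even
inner vertex of a long thread. Unless everything is clean, such a chance to waste is then still
present, as the sharper bound for positions without chances requires. -/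
theorem State.MaxSafe.turn (h : s.MaxSafe) (hn : 3 ≤ n) (hk : k ≤ n) {v : SunletVertex n k}
    (hv : v ∈ s.dirty) (hT : Turn (subdividedSunlet n k) s v t) : t.MinSafe := by
  have hsne : s.dirty.Nonempty := ⟨v, hv⟩
  have hlt := h.total_lt hn hk hsne
  have hcost := h.cost_le hsne
  have htot := hT.total
  have hd := hT.card_longThreads_le
  have key : t.dirty.Nonempty → t.cost ≤ 2 * n + 2 * k ∧
      (t.evenHubs.card + t.longThreads.card = 0 → t.cost + 2 ≤ 2 * n + 2 * k) := by
    intro hne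
    have hQ := hT.deficit_le_of_nonempty hn h.settled hne
    unfold State.cost at *
    obtain ⟨i, j, hj, rfl⟩ := exists_knot v
    rcases Nat.eq_zero_or_pos j with rfl | hj0
    · have he := hT.card_evenHubs_hub_le hv
      change _ ≤ _ - 2 * ((s.load _ (hub k i) % 2 : ℕ) : ℤ) at hQ
      omega
    · obtain ⟨j, rfl⟩ := Nat.exists_eq_succ_of_ne_zero hj0.ne'
      change _ ≤ _ - 2 * ((s.load _ (knot i (j + 1) hj) % 2 : ℕ) : ℤ) at hQ
      have he := Finset.card_le_card (hT.evenHubs_subset fun c hc => by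
        have := (knot_inj.1 hc).2
        omega)
      rcases Nat.mod_two_eq_zero_or_one
        (s.load (subdividedSunlet n k) (knot i (j + 1) hj)) with hl | hl
      -- A short thread consists of its tip, whose load is 1, so an even load means a long thread;
      -- the wasted brush leaves it dirty.
      · have htip := h.settled.tip_mem hj hv
        have hik : i.val < k := by
          by_contra hik
          have hL := threadLength_of_le (not_lt.1 hik)
          have h1 : knot i (j + 1) hj = tip k i := knot_inj.2 ⟨rfl, by omega⟩
          have h2 := (h.settled.tip_spec htip).2.2
          rw [h1] at hl
          omega
        have : 0 < t.longThreads.card := Finset.card_pos.2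
          ⟨i, State.mem_longThreads.2 ⟨hik, hT.dirty_eq hl ▸ htip⟩⟩
        omega
      · omega
  refine ⟨hT.settled, by omega, fun hne => (key hne).1, fun hne => (key hne).2, fun hne hc => ?_⟩
  obtain ⟨h1, h2⟩ := h.of_hubs hsne fun i => hT.subset (hc i)
  refine ⟨by omega, fun h3 => ?_⟩
  have := h2 h3
  omega

theorem Turn.tip_notMem {i : Fin n} (hs : s.Settled (subdividedSunlet n k))
    (hi : tip k i ∈ s.dirty) (hT : Turn (subdividedSunlet n k) s (tip k i) t) :
    tip k i ∉ t.dirty := by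
  intro h
  have h1 := hT.load _ h
  rw [if_pos rfl, (hs.tip_spec hi).2.2, (hT.settled.tip_spec h).2.2] at h1
  omega

theorem State.MinSafe.exists_move (h : s.MinSafe) (hn : 3 ≤ n) (hk1 : 1 ≤ k) (hk : k ≤ n)
    (hk' : k ≠ n - 1) (hne : s.dirty.Nonempty) :
    ∃ v ∈ s.dirty, ∀ t, Turn (subdividedSunlet n k) s v t → t.MaxSafe := by
  have hs := h.settled
  have hlt := h.total_lt hn hk hk' hne
  have hcost := h.cost_le hne
  have hcost' := h.cost_le' hne
  -- When every thread is long and at most one is dirty, Min ends the game at once: a cycle vertex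
  -- with a clean thread fires, and one thread cannot support a dirty arc.
  by_cases hB : (∀ i, hub k i ∈ s.dirty) ∧ k = n ∧ s.longThreads.card ≤ 1
  · obtain ⟨hc, hkn, hd⟩ := hB
    obtain ⟨i, hi⟩ : ∃ i, i ∉ s.longThreads := by
      by_contra! hall
      have := Finset.card_le_card fun i (_ : i ∈ (Finset.univ : Finset (Fin n))) => hall i
      rw [Finset.card_fin] at this
      omega
    have htip : tip k i ∉ s.dirty := fun h' =>
      hi (State.mem_longThreads.2 ⟨hkn ▸ i.isLt, h'⟩)
    refine ⟨hub k i, hc i, fun t hT => ?_⟩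
    have hhub : hub k i ∉ t.dirty := by
      intro h'
      have h1 := hT.settled.load_lt _ h'
      have h2 := hT.load _ h'
      rw [if_pos rfl] at h2
      have h3 := hs.three_le_load hn (hc i)
      rw [hT.settled.dirtyDegree_hub hn, if_neg fun h4 => htip (hT.subset h4)] at h1
      split_ifs at h1 <;> omega
    have hempty : t.dirty = ∅ := hT.settled.dirty_eq_empty hn ⟨i, hhub⟩ fun a b ha hb =>
      Finset.card_le_one.1 hd a (State.mem_longThreads.2 ⟨hkn ▸ a.isLt, hT.subset ha⟩)
        b (State.mem_longThreads.2 ⟨hkn ▸ b.isLt, hT.subset hb⟩)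
    have hnot : ¬ t.dirty.Nonempty := by simp [hempty]
    exact ⟨hT.settled, by rw [hT.total]; omega, fun h' => absurd h' hnot,
      fun h' => absurd h' hnot⟩
  -- Brushing the tip cleans a long thread without waste, removing one of Max's chances.
  by_cases hd : s.longThreads.Nonempty
  · obtain ⟨i, hi⟩ := hd
    obtain ⟨hik, htip⟩ := State.mem_longThreads.1 hi
    refine ⟨tip k i, htip, fun t hT => ?_⟩
    have htot := hT.total
    have hnot := hT.tip_notMem hs htip
    have hd' : t.longThreads.card < s.longThreads.card :=
      Finset.card_lt_card ⟨hT.longThreads_subset, fun hsub =>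
        hnot (State.mem_longThreads.1 (hsub hi)).2⟩
    have he := Finset.card_le_card (hT.evenHubs_subset fun c hc => absurd hc hub_ne_tip)
    refine ⟨hT.settled, by omega, fun hne' => ?_, fun hne' hc => ?_⟩
    · have hQ := hT.deficit_le_of_nonempty hn hs hne'
      rw [(hs.tip_spec htip).2.2] at hQ
      unfold State.cost at *
      omega
    · have hc' : ∀ i, hub k i ∈ s.dirty := fun i => hT.subset (hc i)
      obtain ⟨h1, -⟩ := h.of_hubs hne hc'
      refine ⟨by omega, fun hkn => ?_⟩
      have : 1 < s.longThreads.card := not_le.1 fun h2 => hB ⟨hc', hkn, h2⟩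
      omega
  have hd0 : s.longThreads.card = 0 := by
    rw [Finset.card_eq_zero]
    exact Finset.not_nonempty_iff_eq_empty.1 hd
  by_cases hev : s.evenHubs.Nonempty
  · obtain ⟨i, hi⟩ := hev
    obtain ⟨hhub, hl⟩ := State.mem_evenHubs.1 hi
    have h3 := hs.three_le_load hn hhub
    -- An even load is at least 4, so the dirty degree is 3. Cleaning this thread lowers it to at
    -- most 2 and the cycle vertex fires.
    have htip : tip k i ∈ s.dirty := by
      have h1 := hs.load_lt _ hhub
      rw [hs.dirtyDegree_hub hn] at h1
      by_contra h2
      rw [if_neg h2] at h1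
      split_ifs at h1 <;> omega
    refine ⟨tip k i, htip, fun t hT => ?_⟩
    have htot := hT.total
    have hnot := hT.tip_notMem hs htip
    have hhub' : hub k i ∉ t.dirty := by
      intro h'
      have h1 := hT.settled.load_lt _ h'
      have h2 := hT.load _ h'
      rw [if_neg hub_ne_tip] at h2
      rw [hT.settled.dirtyDegree_hub hn, if_neg hnot] at h1
      split_ifs at h1 <;> omega
    have hd' := hT.card_longThreads_le
    have he : t.evenHubs.card < s.evenHubs.card :=
      Finset.card_lt_card ⟨hT.evenHubs_subset fun c hc => absurd hc hub_ne_tip, fun hsub =>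
        hhub' (State.mem_evenHubs.1 (hsub hi)).1⟩
    refine ⟨hT.settled, by omega, fun hne' => ?_, fun hne' hc => absurd (hc i) hhub'⟩
    have hQ := hT.deficit_le_of_nonempty hn hs hne'
    rw [(hs.tip_spec htip).2.2] at hQ
    unfold State.cost at *
    omega
  have hev0 : s.evenHubs.card = 0 := by
    rw [Finset.card_eq_zero]
    exact Finset.not_nonempty_iff_eq_empty.1 hev
  have hcost := hcost' (by omega)
  by_cases hc : ∀ i, hub k i ∈ s.dirty
  · have h0k : ((0 : Fin n) : ℕ) < k := by simp; omega
    have htip : tip k 0 ∉ s.dirty := fun h' =>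
      hd ⟨0, State.mem_longThreads.2 ⟨h0k, h'⟩⟩
    refine ⟨hub k 0, hc 0, fun t hT => ?_⟩
    have htot := hT.total
    have h3 := hs.three_le_load hn (hc 0)
    have hl : s.load (subdividedSunlet n k) (hub k 0) = 3 := by
      have h1 := hs.load_lt _ (hc 0)
      rw [hs.dirtyDegree_hub hn, if_neg htip] at h1
      split_ifs at h1 <;> omega
    have hhub' : hub k 0 ∉ t.dirty := by
      intro h'
      have h1 := hT.settled.load_lt _ h'
      have h2 := hT.load _ h'
      rw [if_pos rfl] at h2
      rw [hT.settled.dirtyDegree_hub hn, if_neg fun h4 => htip (hT.subset h4)] at h1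
      split_ifs at h1 <;> omega
    have hd' := hT.card_longThreads_le
    have he := Finset.card_le_card (hT.evenHubs_subset fun c hc => hc ▸ hhub')
    refine ⟨hT.settled, by omega, fun hne' => ?_, fun hne' hc => absurd (hc 0) hhub'⟩
    have hQ := hT.deficit_le_of_nonempty hn hs hne'
    rw [hl] at hQ
    unfold State.cost at *
    omega
  · push Not at hc
    obtain ⟨i, -, -, hi, -⟩ := hs.exists_arc_ends hn hne hc
    have htip := (hs.arc_end hn hi.1 (Or.inl hi.2)).1
    refine ⟨tip k i, htip, fun t hT => ?_⟩
    have htot := hT.total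
    have hd' := hT.card_longThreads_le
    have he := Finset.card_le_card (hT.evenHubs_subset fun c hc => absurd hc hub_ne_tip)
    refine ⟨hT.settled, by omega, fun hne' => ?_,
      fun hne' hc => absurd (hT.subset (hc (i + 1))) hi.2⟩
    have hQ := hT.deficit_le_of_nonempty hn hs hne'
    rw [(hs.tip_spec htip).2.2] at hQ
    unfold State.cost at *
    omega

theorem endsWithin_of_safe (hn : 3 ≤ n) (hk1 : 1 ≤ k) (hk : k ≤ n) (hk' : k ≠ n - 1) (T : ℕ) :
    (∀ s : State (SunletVertex n k), s.MinSafe → s.total + T + 1 = n + k →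
      EndsWithin (subdividedSunlet n k) T .min s) ∧
    (∀ s : State (SunletVertex n k), s.MaxSafe → s.total + T + 1 = n + k →
      EndsWithin (subdividedSunlet n k) T .max s) := by
  induction T with
  | zero =>
    constructor
    · intro s hs hT
      change s.dirty = ∅
      by_contra hne
      have := hs.total_lt hn hk hk' (Finset.nonempty_iff_ne_empty.2 hne)
      omega
    · intro s hs hT
      change s.dirty = ∅
      by_contra hne
      have := hs.total_lt hn hk (Finset.nonempty_iff_ne_empty.2 hne)
      omega
  | succ T ih =>
    constructor
    · intro s hs hT
      rcases Finset.eq_empty_or_nonempty s.dirty with hne | hne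
      · exact Or.inl hne
      obtain ⟨v, hv, hmove⟩ := hs.exists_move hn hk1 hk hk' hne
      refine Or.inr ⟨v, hv, fun t ht => ?_⟩
      have htu := ht.turn _ hs.settled hv
      exact ih.2 t (hmove t htu) (by rw [htu.total]; omega)
    · intro s hs hT
      refine Or.inr fun v hv t ht => ?_
      have htu := ht.turn _ hs.settled hv
      exact ih.1 t (hs.turn hn hk hv htu) (by rw [htu.total]; omega)

theorem minSafe_initial (hn : 3 ≤ n) (hk1 : 1 ≤ k) (hk : k ≤ n) :
    (initial fun _ : SunletVertex n k => 0).MinSafe := by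
  have h0 : (initial fun _ : SunletVertex n k => 0).total = 0 := by
    rw [total_initial]; simp
  have hd : (initial fun _ : SunletVertex n k => 0).longThreads.card = k := by
    have : (initial fun _ : SunletVertex n k => 0).longThreads =
        Finset.univ.filter fun i : Fin n => i.val < k := by
      ext i
      simp [State.mem_longThreads, initial]
    rw [this, Fin.card_filter_val_lt, min_eq_right hk]
  have he : (initial fun _ : SunletVertex n k => 0).evenHubs.card = 0 := by
    rw [Finset.card_eq_zero, Finset.eq_empty_iff_forall_notMem]
    intro i hi
    have h1 := (State.mem_evenHubs.1 hi).2
    have h2 : (initial fun _ : SunletVertex n k => 0).load (subdividedSunlet n k) (hub k i) =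
      degIn (subdividedSunlet n k) Finset.univ (hub k i) := Nat.zero_add _
    rw [h2, degIn_hub hn] at h1
    simp at h1
  refine ⟨settled_initial hn, by omega, fun _ => ?_, fun _ h => ?_, fun _ _ => ?_⟩
  · unfold State.cost
    rw [deficit_initial hn, h0, hd, he]
    push_cast
    omega
  · omega
  · rw [h0, hd]
    omega

theorem gameBrushNumber_subdividedSunlet (hn : 3 ≤ n) (hk1 : 1 ≤ k) (hk : k ≤ n)
    (hk' : k ≠ n - 1) : gameBrushNumber (subdividedSunlet n k) = n + k - 1 := by
  have hstart : StabilizesTo (subdividedSunlet n k) (initial fun _ => 0) (initial fun _ => 0) :=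
    ⟨Relation.ReflTransGen.refl, fun v hv => by
      have h1 := (canFire_iff _).1 hv
      have h2 := (settled_initial (k := k) hn).load_lt v h1.1
      omega⟩
  have hmem : n + k - 1 ∈ {T | ∀ s, StabilizesTo (subdividedSunlet n k) (initial fun _ => 0) s →
      EndsWithin (subdividedSunlet n k) T .min s} := by
    intro s hs
    have hss : s = initial fun _ => 0 := by
      rcases Relation.ReflTransGen.cases_head hs.1 with h | ⟨_, ⟨v, hv, -⟩, -⟩
      · exact h.symm
      · exact absurd hv (hstart.2 v)
    rw [hss]
    have h0 : (initial fun _ : SunletVertex n k => 0).total = 0 := by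
      rw [total_initial]; simp
    exact (endsWithin_of_safe hn hk1 hk hk' _).1 _ (minSafe_initial hn hk1 hk) (by omega)
  refine le_antisymm (Nat.sInf_le hmem) ?_
  exact le_of_endsWithin_initial hn hk (Nat.sInf_mem ⟨_, hmem⟩ _ hstart)

end Upper

/-- Every rational number in `[1, 2)` has the form `(n + k - 1) / n`. -/
theorem exists_ratio_eq {r : ℚ} (h1 : 1 ≤ r) (h2 : r < 2) :
    ∃ n k : ℕ, 3 ≤ n ∧ 1 ≤ k ∧ k ≤ n ∧ k ≠ n - 1 ∧ ((n + k - 1 : ℕ) : ℚ) / (n : ℚ) = r := by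
  obtain ⟨a, ha⟩ := Int.eq_ofNat_of_zero_le (Rat.num_nonneg.2 (zero_le_one.trans h1))
  have hb : 0 < r.den := r.den_pos
  have hbq : (0 : ℚ) < r.den := by exact_mod_cast hb
  have hr : r = (a : ℚ) / r.den := by
    conv_lhs => rw [← Rat.num_div_den r, ha]
    simp
  have hab : r.den ≤ a := by
    rw [hr, le_div_iff₀ hbq, one_mul] at h1
    exact_mod_cast h1
  have hab' : a < 2 * r.den := by
    rw [hr, div_lt_iff₀ hbq] at h2
    exact_mod_cast h2
  -- The factor 3 gives `n ≥ 3` and separates `k`, which is 1 modulo 3, from `n - 1`, which is 2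
  -- modulo 3.
  refine ⟨3 * r.den, 3 * (a - r.den) + 1, by omega, by omega, by omega, by omega, ?_⟩
  rw [show 3 * r.den + (3 * (a - r.den) + 1) - 1 = 3 * a by omega]
  push_cast
  rw [mul_div_mul_left _ _ (by norm_num : (3 : ℚ) ≠ 0)]
  exact hr.symm

end Brushing

theorem mainTheorem4 :
    (∀ r : ℚ, 1 ≤ r → r < 2 →
      ∃ n k : ℕ, 3 ≤ n ∧ 1 ≤ k ∧ k ≤ n ∧ k ≠ n - 1 ∧
        (Brushing.gameBrushNumber (Brushing.subdividedSunlet n k) : ℚ) /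
          (Brushing.brushNumber (Brushing.subdividedSunlet n k) : ℚ) = r) ∧
    (∀ n k : ℕ, 3 ≤ n → 1 ≤ k → k ≤ n →
      Brushing.brushNumber (Brushing.subdividedSunlet n k) = n ∧
      (k ≠ n - 1 → Brushing.gameBrushNumber (Brushing.subdividedSunlet n k) = n + k - 1)) := by
  constructor
  · intro r h1 h2
    obtain ⟨n, k, hn, hk1, hk, hk', hr⟩ := Brushing.exists_ratio_eq h1 h2
    have : NeZero n := ⟨by omega⟩
    refine ⟨n, k, hn, hk1, hk, hk', ?_⟩
    rw [Brushing.gameBrushNumber_subdividedSunlet hn hk1 hk hk',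
      Brushing.brushNumber_subdividedSunlet hn, hr]
  · intro n k hn hk1 hk
    have : NeZero n := ⟨by omega⟩
    exact ⟨Brushing.brushNumber_subdividedSunlet hn,
      Brushing.gameBrushNumber_subdividedSunlet hn hk1 hk⟩
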